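/- Let $\mathcal{E}$ be a Grothendieck topos, i.e. a locally small category equivalent to the category of sheaves of sets on a small site. Let $\gamma_0\colon\mathbf{Set}\to\mathcal{E}$ denote the (essentially unique) cocontinuous functor that preserves finite limits. The topos $\mathcal{E}$ is \emph{completely connected} if $\gamma_0$ has a left adjoint $\gamma_1$ and $\gamma_1$ has a left adjoint $\gamma_2$. An object $X$ of $\mathcal{E}$ is a \emph{container object} if the functor $\mathcal{E}(X,-)\colon\mathcal{E}\to\mathbf{Set}$ is left adjoint to $\gamma_0$. Let $\mathbf{Fam}(\mathcal{E})$ be the category of set-indexed families of objects of $\mathcal{E}$: a morphism $(X_i)_{i\in I}\to(Y_j)_{j\in J}$ is a function $\alpha\colon I\to J$ together with morphisms $X_i\to Y_{\alpha(i)}$ for $i\in I$. For a subterminal object $U$ of a Grothendieck topos $\mathcal{F}$, the \emph{closed complement} of $U$ is the subtopos of $\mathcal{F}$ whose objects are the sheaves for the closed local operator $U\vee(-)$, i.e. the objects $X$ such that, for every monomorphism $A\hookrightarrow B$ with $A\vee(B\times U)=B$ as subobjects of $B$, every morphism $A\to X$ extends uniquely along $A\hookrightarrow B$ to a morphism $B\to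 X$. A \emph{closed subtopos} of $\mathcal{F}$ is a geometric embedding into $\mathcal{F}$ whose image is the closed complement of some subterminal object. Then every Grothendieck topos $\mathcal{E}$ is a closed subtopos of a completely connected Grothendieck topos. Namely, $\mathbf{Fam}(\mathcal{E})$ is a completely connected Grothendieck topos; the one-member family $\boxtimes=\{0_{\mathcal{E}}\}$ on the initial object of $\mathcal{E}$ is a subterminal container object of $\mathbf{Fam}(\mathcal{E})$; and the functor $\mathcal{E}\to\mathbf{Fam}(\mathcal{E})$, $X\mapsto\{X\}$, is the direct image of a geometric embedding that exhibits $\mathcal{E}$ as the closed complement of $\boxtimes$ in $\mathbf{Fam}(\mathcal{E})$. -/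

import Mathlib

open CategoryTheory CategoryTheory.Limits

universe w u u'

/-- A Grothendieck topos (over the base `Type w`): a locally small category equivalent to the
category of sheaves of sets on a small site. -/
class IsGrothendieckTopos (E : Type u) [Category.{w} E] : Prop where
  exists_site : ∃ (C : Type w) (_ : SmallCategory C) (J : GrothendieckTopology C),
    Nonempty (E ≌ Sheaf J (Type w))

instance IsGrothendieckTopos.hasInitial (E : Type u) [Category.{w} E] [IsGrothendieckTopos E] :
    HasInitial E := by
  obtain ⟨C, _, J, ⟨e⟩⟩ := IsGrothendieckTopos.exists_site (E := E)
  have : HasSheafify J (Type w) := inferInstance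
  have : HasInitial (Sheaf J (Type w)) :=
    hasColimitsOfShape_of_reflective (sheafToPresheaf J (Type w))
  exact Adjunction.hasColimitsOfShape_of_equivalence e.functor

/-- `γ : Set ⥤ E` is the functor `γ₀`: it is cocontinuous and preserves finite limits
(for a Grothendieck topos `E` such a functor exists and is unique up to isomorphism). -/
structure IsGammaZero {E : Type u} [Category.{w} E] (γ : Type w ⥤ E) : Prop where
  preservesColimits : PreservesColimitsOfSize.{w, w} γ
  preservesFiniteLimits : PreservesFiniteLimits γ

/-- A completely connected Grothendieck topos: there are functors `γ₂ ⊣ γ₁ ⊣ γ₀`. -/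
def IsCompletelyConnected (E : Type u) [Category.{w} E] : Prop :=
  IsGrothendieckTopos E ∧
    ∃ (γ₀ : Type w ⥤ E) (γ₁ : E ⥤ Type w) (γ₂ : Type w ⥤ E),
      IsGammaZero γ₀ ∧ Nonempty (γ₁ ⊣ γ₀) ∧ Nonempty (γ₂ ⊣ γ₁)

/-- `X` is a container object: the functor `E(X, -) : E ⥤ Set` is left adjoint to `γ₀`. -/
def IsContainerObject {E : Type u} [Category.{w} E] (X : E) : Prop :=
  ∃ γ₀ : Type w ⥤ E, IsGammaZero γ₀ ∧ Nonempty (coyoneda.obj (Opposite.op X) ⊣ γ₀)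

/-- The category of families of objects of `E` indexed by sets: an object is `(I, (Xᵢ)_{i ∈ I})`, a
morphism `(I, X) ⟶ (J, Y)` is a map `f : I → J` with morphisms `Xᵢ ⟶ Y_{f i}`. -/
abbrev Fam (E : Type u) [Category.{w} E] : Type (max u (w + 1)) := FormalCoproduct.{w} E

/-- The embedding of `E` in `Fam E` that sends `X` to the one-member family `{X}`. -/
abbrev Fam.singleton (E : Type u) [Category.{w} E] : E ⥤ Fam E := FormalCoproduct.incl E

/-- The one-member family `{0}` on the initial object. -/
noncomputable def Fam.box (E : Type u) [Category.{w} E] [IsGrothendieckTopos E] : Fam E :=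
  (Fam.singleton E).obj (⊥_ E)

/-- A geometric morphism `E → F`. -/
structure GeometricMorphism (E : Type u) [Category.{w} E] (F : Type u') [Category.{w} F] where
  directImage : E ⥤ F
  inverseImage : F ⥤ E
  adj : inverseImage ⊣ directImage
  lex : PreservesFiniteLimits inverseImage

/-- A geometric embedding (a subtopos inclusion): the direct image is fully faithful. -/
def GeometricMorphism.IsEmbedding {E : Type u} [Category.{w} E] {F : Type u'} [Category.{w} F]
    (i : GeometricMorphism E F) : Prop :=
  i.directImage.Full ∧ i.directImage.Faithful

/-- `P` is the subobject `B × U` of `B`, i.e. the pullback of the subterminal object `U ↪ 1` along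
`B ⟶ 1`: a morphism `Z ⟶ B` factors through `P` if and only if there is a morphism `Z ⟶ U`. -/
def IsRestriction {F : Type u} [Category.{w} F] (U : F) {B : F} (P : Subobject B) : Prop :=
  ∀ ⦃Z : F⦄ (f : Z ⟶ B), P.Factors f ↔ Nonempty (Z ⟶ U)

/-- `A'` is the closure of the subobject `A` of `B` for the closed local operator `U ∨ (-)` of the
subterminal object `U`: it is the union of `A` and `B × U`. -/
def IsClosedClosure {F : Type u} [Category.{w} F] (U : F) {B : F} (A A' : Subobject B) : Prop :=
  ∃ P : Subobject B, IsRestriction U P ∧ IsLUB {A, P} A'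

/-- `X` is a sheaf for the closed local operator `U ∨ (-)`: every morphism to `X` from a dense
subobject `A ↪ B` (one whose closure is all of `B`) extends uniquely to `B`. -/
def IsClosedSheaf {F : Type u} [Category.{w} F] (U X : F) : Prop :=
  ∀ ⦃A B : F⦄ (m : A ⟶ B) [Mono m], IsClosedClosure U (Subobject.mk m) ⊤ →
    ∀ f : A ⟶ X, ∃! g : B ⟶ X, m ≫ g = f

/-- The geometric morphism `i : E → F` exhibits `E` as the closed subtopos of `F` complementary to
the subterminal object `U`: it is an embedding, and the objects in (the essential image of) `E` are
the sheaves for the local operator `U ∨ (-)`. -/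
structure IsClosedComplement {E : Type u} [Category.{w} E] {F : Type u'} [Category.{w} F]
    (i : GeometricMorphism E F) (U : F) : Prop where
  isSubterminal : IsSubterminal U
  isEmbedding : i.IsEmbedding
  essImage_iff : ∀ X : F, i.directImage.essImage X ↔ IsClosedSheaf U X

/-- `E` is a closed subtopos of `F`. -/
def IsClosedSubtopos (E : Type u) [Category.{w} E] (F : Type u') [Category.{w} F] : Prop :=
  ∃ (i : GeometricMorphism E F) (U : F), IsClosedComplement i U

/-! Write 0 and 1 for the initial and terminal objects of E. There is a chain of adjunctions:
constant families on 0 ⊣ index set ⊣ constant families on 1 ⊣ Hom({1}, -). The third functor is a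
left and a right adjoint, hence is γ₀; the other two are γ₂ and γ₁. A morphism {0} ⟶ X is just an
index of X, so {0} represents γ₁ and is a container object.

The subobject B × {0} keeps every index of B and replaces each member by 0. Its union with A has the
fibre of A over indices met by A and 0 elsewhere (`exists_closure`), so a morphism from A to a
one-member family extends uniquely to the union. Conversely, the empty family is dense in {0}, and
the sheaf condition there says that X has exactly one index.

If E is sheaves on C, then Fam E is sheaves on C with an initial object `star` added: F(star) is the
index set, and the fibres of F over its elements are the members (`toSheaf`). The left adjoint of X
↦ {X} is the coproduct, obtained by sheafifying the disjoint union of presheaves (`sigma`); it is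
left exact because `sigma` and sheafification are. -/

namespace Fam

/-! ### The adjoint string between sets and families. -/

variable {E : Type u} [Category.{w} E]

/-- The functor that sends a set `I` to the constant family on `T` indexed by `I`. -/
def constant (T : E) : Type w ⥤ Fam E where
  obj I := ⟨I, fun _ => T⟩
  map f := ⟨f, fun _ => 𝟙 T⟩
  map_comp f g := FormalCoproduct.hom_ext rfl fun i => by simp

variable (E) in
/-- The functor that sends a family to its index set. -/
def index : Fam E ⥤ Type w where
  obj X := X.I
  map f := ↾f.f

/-- The index functor is left adjoint to the functor of constant terminal families. -/
def indexAdjConstant {T : E} (hT : IsTerminal T) : index E ⊣ constant T :=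
  Adjunction.mkOfHomEquiv
    { homEquiv := fun _ _ =>
        { toFun := fun f => ⟨f, fun _ => hT.from _⟩
          invFun := fun g => ↾g.f
          left_inv := fun _ => rfl
          right_inv := fun _ => FormalCoproduct.hom_ext rfl fun _ => hT.hom_ext _ _ }
      homEquiv_naturality_left_symm := fun _ _ => rfl
      homEquiv_naturality_right := fun _ _ =>
        FormalCoproduct.hom_ext rfl fun _ => hT.hom_ext _ _ }

/-- The functor of constant initial families is left adjoint to the index functor. -/
def constantAdjIndex {T : E} (hT : IsInitial T) : constant T ⊣ index E :=
  Adjunction.mkOfHomEquiv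
    { homEquiv := fun _ _ =>
        { toFun := fun g => ↾g.f
          invFun := fun f => ⟨f, fun _ => hT.to _⟩
          left_inv := fun _ => FormalCoproduct.hom_ext rfl fun _ => hT.hom_ext _ _
          right_inv := fun _ => rfl }
      homEquiv_naturality_left_symm := fun _ _ =>
        FormalCoproduct.hom_ext rfl fun _ => hT.hom_ext _ _
      homEquiv_naturality_right := fun _ _ => rfl }

/-- Constant families on `T` are copowers of the one-member family `{T}`. -/
def constantAdjCoyoneda (T : E) :
    constant T ⊣ coyoneda.obj (Opposite.op ((Fam.singleton E).obj T)) :=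
  Adjunction.mkOfHomEquiv
    { homEquiv := fun _ X =>
        { toFun := fun g => ↾fun i => (⟨fun _ => g.f i, fun _ => g.φ i⟩ :
            (Fam.singleton E).obj T ⟶ X)
          invFun := fun h =>
            ⟨fun i => (show (Fam.singleton E).obj T ⟶ X from h i).f PUnit.unit,
             fun i => (show (Fam.singleton E).obj T ⟶ X from h i).φ PUnit.unit⟩
          left_inv := fun _ => rfl
          right_inv := fun _ => rfl }
      homEquiv_naturality_left_symm := fun _ _ =>
        FormalCoproduct.hom_ext rfl fun _ => (Category.comp_id _).trans (Category.id_comp _).symm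
      homEquiv_naturality_right := fun _ _ => rfl }

lemma isGammaZero_constant {T : E} (hT : IsTerminal T) : IsGammaZero (constant T) where
  preservesColimits := (constantAdjCoyoneda T).leftAdjoint_preservesColimits
  preservesFiniteLimits :=
    have := (indexAdjConstant hT).rightAdjoint_preservesLimits
    PreservesLimits.preservesFiniteLimits _

/-- The one-member family on an initial object represents the index functor. -/
def coyonedaSingletonIsoIndex {T : E} (hT : IsInitial T) :
    coyoneda.obj (Opposite.op ((Fam.singleton E).obj T)) ≅ index E :=
  NatIso.ofComponents fun X =>
    { hom := ↾fun g => (show (Fam.singleton E).obj T ⟶ X from g).f PUnit.unit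
      inv := ↾fun i => (⟨fun _ => i, fun _ => hT.to _⟩ : (Fam.singleton E).obj T ⟶ X)
      hom_inv_id := by
        ext g
        exact FormalCoproduct.hom_ext rfl fun _ => hT.hom_ext _ _
      inv_hom_id := rfl }

end Fam

namespace IsGrothendieckTopos

variable (E : Type u) [Category.{w} E] [IsGrothendieckTopos E]

instance hasTerminal : HasTerminal E := by
  obtain ⟨C, _, J, ⟨e⟩⟩ := IsGrothendieckTopos.exists_site (E := E)
  exact Adjunction.hasLimitsOfShape_of_equivalence e.functor

instance hasStrictInitialObjects : HasStrictInitialObjects E := by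
  obtain ⟨C, _, J, ⟨e⟩⟩ := IsGrothendieckTopos.exists_site (E := E)
  refine ⟨fun {I A} f hI => ?_⟩
  have : PreservesColimit (Functor.empty E) e.functor :=
    e.toAdjunction.leftAdjoint_preservesColimits.preservesColimitsOfShape.preservesColimit
  have : IsIso (e.functor.map f) :=
    (IsInitial.isInitialObj e.functor I hI).isIso_to _
  exact isIso_of_reflects_iso f e.functor

end IsGrothendieckTopos

lemma isContainerObject_box (E : Type u) [Category.{w} E] [IsGrothendieckTopos E] :
    IsContainerObject (Fam.box E) :=
  ⟨Fam.constant (⊤_ E), Fam.isGammaZero_constant terminalIsTerminal,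
    ⟨(Fam.indexAdjConstant terminalIsTerminal).ofNatIsoLeft
      (Fam.coyonedaSingletonIsoIndex initialIsInitial).symm⟩⟩

lemma Fam.isCompletelyConnected (E : Type u) [Category.{w} E] [IsGrothendieckTopos E]
    (h : IsGrothendieckTopos (Fam E)) : IsCompletelyConnected (Fam E) :=
  ⟨h, Fam.constant (⊤_ E), Fam.index E, Fam.constant (⊥_ E),
    Fam.isGammaZero_constant terminalIsTerminal,
    ⟨Fam.indexAdjConstant terminalIsTerminal⟩, ⟨Fam.constantAdjIndex initialIsInitial⟩⟩

/-! ### Closed sheaves for {0} are the one-member families. -/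

namespace Fam

variable {E : Type u} [Category.{w} E]

/-- Morphisms {0} ⟶ A correspond to indices of A, so cancelling `m` on them cancels `m.f`. -/
lemma injective_of_mono [HasInitial E] {A B : Fam E} (m : A ⟶ B) [Mono m] :
    Function.Injective m.f := by
  intro i j hij
  let g (i : A.I) : (Fam.singleton E).obj (⊥_ E) ⟶ A := ⟨fun _ => i, fun _ => initial.to _⟩
  have : g i ≫ m = g j ≫ m :=
    FormalCoproduct.hom_ext (funext fun _ => hij) fun _ => initialIsInitial.hom_ext _ _
  exact congrArg (fun h : (Fam.singleton E).obj (⊥_ E) ⟶ A => h.f PUnit.unit)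
    ((cancel_mono m).1 this)

lemma mono_component {A B : Fam E} (m : A ⟶ B) [Mono m] (i : A.I) : Mono (m.φ i) where
  right_cancellation {Z} g h hgh := by
    let k (g : Z ⟶ A.obj i) : (Fam.singleton E).obj Z ⟶ A := ⟨fun _ => i, fun _ => g⟩
    have : k g ≫ m = k h ≫ m :=
      FormalCoproduct.hom_ext rfl fun _ => (Category.comp_id _).trans hgh
    obtain ⟨_, h₂⟩ := (FormalCoproduct.hom_ext_iff _ _).1 ((cancel_mono m).1 this)
    exact (Category.comp_id _).symm.trans (h₂ PUnit.unit)

lemma mono_mk {I : Type w} {X Y : I → E} (q : ∀ i, X i ⟶ Y i) [∀ i, Mono (q i)] :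
    Mono (C := Fam E) (X := ⟨I, X⟩) (Y := ⟨I, Y⟩) (FormalCoproduct.Hom.mk id q) where
  right_cancellation {Z} g h hgh := by
    obtain ⟨g, φ⟩ := g
    obtain ⟨h, ψ⟩ := h
    obtain ⟨h₁, h₂⟩ := (FormalCoproduct.hom_ext_iff _ _).1 hgh
    obtain rfl : g = h := h₁
    refine FormalCoproduct.hom_ext rfl fun i => (Category.comp_id _).trans ?_
    exact (cancel_mono (q (g i))).1 ((Category.comp_id _).symm.trans (h₂ i))

/-- A fibre of the union of a subobject `A` of `B` with the constant initial family: it is the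
fibre of `A` if there is one, and the initial object otherwise. -/
lemma exists_closure_component [HasInitial E] [HasStrictInitialObjects E] {A B : Fam E}
    (m : A ⟶ B) [Mono m] (k : B.I) :
    ∃ (Q : E) (q : Q ⟶ B.obj k) (t : ∀ l, m.f l = k → (A.obj l ⟶ Q)), Mono q ∧
      (∀ l (h : m.f l = k), t l h ≫ q = m.φ l ≫ eqToHom (by rw [h])) ∧
      ∀ (Y : E) (f : ∀ l, m.f l = k → (A.obj l ⟶ Y)),
        ∃! g : Q ⟶ Y, ∀ l (h : m.f l = k), t l h ≫ g = f l h := by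
  by_cases hk : ∃ l, m.f l = k
  · obtain ⟨l, rfl⟩ := hk
    -- The fibre over `k` has at most one index, so `A.obj l` itself serves as `Q`.
    have hl {l'} (h : m.f l' = m.f l) : l' = l := injective_of_mono m h
    refine ⟨A.obj l, m.φ l, fun l' h => eqToHom (by rw [hl h]), mono_component m l, ?_, ?_⟩
    · intro l' h
      obtain rfl := hl h
      simp
    · intro Y f
      refine ⟨f l rfl, ?_, fun g hg => by simpa using hg l rfl⟩
      intro l' h
      obtain rfl := hl h
      simp
  · refine ⟨⊥_ E, initial.to _, fun l h => (hk ⟨l, h⟩).elim, inferInstance,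
      fun l h => (hk ⟨l, h⟩).elim, fun Y f => ⟨initial.to _, fun l h => (hk ⟨l, h⟩).elim,
        fun _ _ => initialIsInitial.hom_ext _ _⟩⟩

/-- The union `q : Q ⟶ B` of a subobject `m : A ⟶ B` with the constant initial family. -/
lemma exists_closure [HasInitial E] [HasStrictInitialObjects E] {A B : Fam E} (m : A ⟶ B)
    [Mono m] :
    ∃ (Q : Fam E) (q : Q ⟶ B) (t : A ⟶ Q), Mono q ∧ t ≫ q = m ∧
      (∀ {Z : Fam E} (f : Z ⟶ B), (Z ⟶ (Fam.singleton E).obj (⊥_ E)) → ∃ f', f' ≫ q = f) ∧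
      ∀ {Y : E} (f : A ⟶ (Fam.singleton E).obj Y), ∃! g : Q ⟶ (Fam.singleton E).obj Y,
        t ≫ g = f := by
  choose Q q t hq ht hY using exists_closure_component m
  refine ⟨⟨B.I, Q⟩, ⟨id, q⟩, ⟨m.f, fun l => t (m.f l) l rfl⟩, mono_mk q, ?_, ?_, ?_⟩
  · exact FormalCoproduct.hom_ext rfl fun l =>
      (Category.comp_id _).trans ((ht _ l rfl).trans (Category.comp_id _))
  · intro Z f z
    -- A morphism to {0} makes every member of `Z` initial, by strictness.
    have hZ (i : Z.I) : IsInitial (Z.obj i) :=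
      have : IsIso (z.φ i) := initialIsInitial.isIso_to _
      initialIsInitial.ofIso (asIso (z.φ i)).symm
    exact ⟨⟨f.f, fun i => (hZ i).to _⟩, FormalCoproduct.hom_ext rfl fun i => (hZ i).hom_ext _ _⟩
  · intro Y f
    choose g hg hg' using fun k => hY k Y fun l _ => f.φ l
    refine ⟨⟨fun _ => PUnit.unit, g⟩, FormalCoproduct.hom_ext rfl fun l =>
      (Category.comp_id _).trans (hg _ l rfl), ?_⟩
    rintro ⟨g₁, g₂⟩ h
    refine FormalCoproduct.hom_ext rfl fun k => (Category.comp_id _).trans (hg' k _ ?_)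
    rintro l rfl
    exact (Category.comp_id _).symm.trans (((FormalCoproduct.hom_ext_iff _ _).1 h).2 l)

variable [IsGrothendieckTopos E]

lemma isSubterminal_box : IsSubterminal (Fam.box E) := fun _ _ _ =>
  FormalCoproduct.hom_ext (funext fun _ => rfl) fun _ => initial.strict_hom_ext _ _

/-- The subobject `q` of `exists_closure` contains both A and B × {0}, so density makes `q` an
isomorphism, and the extension property of `Q` passes to `B`. -/
lemma isClosedSheaf_singleton (Y : E) : IsClosedSheaf (Fam.box E) ((Fam.singleton E).obj Y) := by
  rintro A B m _ ⟨P, hP, hlub⟩ f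
  obtain ⟨Q, q, t, _, rfl, hq, hQ⟩ := exists_closure m
  have h₁ : Subobject.mk (t ≫ q) ≤ Subobject.mk q := Subobject.mk_le_mk_of_comm t rfl
  have h₂ : P ≤ Subobject.mk q := by
    obtain ⟨z⟩ := (hP P.arrow).1 (P.factors_of_le P.arrow le_rfl (P.factors_self))
    obtain ⟨p, hp⟩ := hq P.arrow z
    exact Subobject.le_mk_of_comm p hp
  have h₃ : (⊤ : Subobject B) ≤ Subobject.mk q := hlub.2 (by
    rintro _ (rfl | rfl)
    exacts [h₁, h₂])
  obtain ⟨s, hs⟩ : ∃ s, s ≫ q = 𝟙 B :=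
    (Subobject.mk_factors_iff q (𝟙 B)).1 (Subobject.factors_of_le _ h₃ (Subobject.top_factors _))
  have hs' : q ≫ s = 𝟙 Q := by rw [← cancel_mono q]; simp [hs]
  obtain ⟨g, hg, hg'⟩ := hQ f
  refine ⟨s ≫ g, ?_, fun g' h => ?_⟩
  · dsimp only
    rw [Category.assoc, reassoc_of% hs', hg]
  · rw [← hg' (q ≫ g') (by simpa using h), reassoc_of% hs]

/-- The sheaf condition is tested on the single monomorphism from the empty family to {0}. -/
lemma exists_iso_singleton_of_isClosedSheaf {X : Fam E} (hX : IsClosedSheaf (Fam.box E) X) :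
    ∃ Y : E, Nonempty ((Fam.singleton E).obj Y ≅ X) := by
  let A : Fam E := ⟨PEmpty, fun x => x.elim⟩
  let hA : IsInitial A := IsInitial.ofUniqueHom
    (fun Z => ⟨fun x => x.elim, fun x => x.elim⟩)
    fun Z f => FormalCoproduct.hom_ext (funext fun x => x.elim) fun x => x.elim
  let m : A ⟶ Fam.box E := hA.to _
  have : Mono m := ⟨fun g h _ => FormalCoproduct.hom_ext
    (funext fun x => (g.f x).elim) fun x => (g.f x).elim⟩
  -- For B = {0} the restriction of B to {0} is all of B, so every subobject of B is dense.
  obtain ⟨g, -, hg⟩ := hX m ⟨⊤, fun Z f => ⟨fun _ => ⟨f⟩, fun _ => Subobject.top_factors f⟩,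
    by
      intro x hx
      simp only [Set.mem_insert_iff, Set.mem_singleton_iff] at hx
      exact le_top, fun x hx => hx (by simp)⟩ (hA.to _)
  -- Existence of the extension gives an index of `X`; uniqueness makes it the only one.
  have hi (i : X.I) : i = g.f PUnit.unit :=
    congrArg (fun h : Fam.box E ⟶ X => h.f PUnit.unit)
      (hg ⟨fun _ => i, fun _ => initial.to _⟩ (hA.hom_ext _ _))
  exact ⟨X.obj (g.f PUnit.unit), ⟨FormalCoproduct.isoOfComponents
    ⟨fun _ => g.f PUnit.unit, fun _ => PUnit.unit, fun _ => rfl, fun i => (hi i).symm⟩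
    fun _ => Iso.refl _⟩⟩

lemma isClosedComplement_box (i : GeometricMorphism E (Fam E))
    (h : i.directImage = Fam.singleton E) : IsClosedComplement i (Fam.box E) where
  isSubterminal := isSubterminal_box
  isEmbedding := by
    rw [GeometricMorphism.IsEmbedding, h]
    exact ⟨inferInstance, inferInstance⟩
  essImage_iff X := by
    rw [h]
    constructor
    · rintro ⟨Y, ⟨e⟩⟩ A B m _ hm f
      obtain ⟨g, hg, hg'⟩ := isClosedSheaf_singleton Y m hm (f ≫ e.inv)
      refine ⟨g ≫ e.hom, ?_, fun g' h => ?_⟩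
      · dsimp only at hg ⊢
        rw [reassoc_of% hg, Iso.inv_hom_id, Category.comp_id]
      · rw [← hg' (g' ≫ e.inv) (by simp [← h]), Category.assoc, Iso.inv_hom_id, Category.comp_id]
    · exact exists_iso_singleton_of_isClosedSheaf

end Fam

open Opposite

/-! ### The site with a freely added initial object. -/

section Site

variable {C : Type w} [SmallCategory C]

/-- The topology on `C` with a freely added initial object in which a sieve is covering if it
contains the morphism from the added object, and if its pullbacks along morphisms from objects of
`C` restrict to covering sieves of `C`. -/
def CategoryTheory.GrothendieckTopology.withInitial (J : GrothendieckTopology C) :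
    GrothendieckTopology (WithInitial C) where
  sieves X := {S | S (WithInitial.starInitial.to X) ∧
    ∀ (c : C) (f : WithInitial.incl.obj c ⟶ X),
      (S.pullback f).functorPullback WithInitial.incl ∈ J c}
  top_mem' X := ⟨True.intro, fun c f => J.top_mem c⟩
  pullback_stable' X Y S f hS := by
    refine ⟨?_, fun c g => ?_⟩
    · have : WithInitial.starInitial.to Y ≫ f = WithInitial.starInitial.to X :=
        WithInitial.starInitial.hom_ext _ _
      simpa [Sieve.pullback_apply, this] using hS.1
    · rw [← Sieve.pullback_comp]
      exact hS.2 c (g ≫ f)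
  transitive' X S hS R hR := by
    refine ⟨?_, fun c f => ?_⟩
    · have : WithInitial.starInitial.to WithInitial.star ≫ WithInitial.starInitial.to X =
        WithInitial.starInitial.to X := WithInitial.starInitial.hom_ext _ _
      simpa [Sieve.pullback_apply, this] using (hR hS.1).1
    · refine J.transitive (hS.2 c f) _ fun d g hg => ?_
      have := (hR hg).2 d (𝟙 _)
      rw [Sieve.pullback_id] at this
      convert this using 1
      ext d' k
      simp [Sieve.functorPullback, Sieve.pullback_apply]

namespace WithInitialPresheaf

/-- Construct a morphism of presheaves on `WithInitial C` from its components. -/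
def homMk {F G : (WithInitial C)ᵒᵖ ⥤ Type w}
    (a : F.obj (op WithInitial.star) → G.obj (op WithInitial.star))
    (b : ∀ c : C, F.obj (op (WithInitial.incl.obj c)) → G.obj (op (WithInitial.incl.obj c)))
    (hb : ∀ (c d : C) (f : c ⟶ d) (x : F.obj (op (WithInitial.incl.obj d))),
      b c (F.map (WithInitial.incl.map f).op x) = G.map (WithInitial.incl.map f).op (b d x))
    (hab : ∀ (c : C) (x : F.obj (op (WithInitial.incl.obj c))),
      a (F.map (WithInitial.homTo c).op x) = G.map (WithInitial.homTo c).op (b c x)) :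
    F ⟶ G where
  app
    | ⟨.of c⟩ => ↾(b c)
    | ⟨.star⟩ => ↾a
  naturality := by
    rintro ⟨d | _⟩ ⟨c | _⟩ ⟨f⟩
    · ext x
      exact hb c d (WithInitial.down f) x
    · obtain rfl : f = WithInitial.homTo d := WithInitial.starInitial.hom_ext _ _
      ext x
      exact hab d x
    · exact (WithInitial.false_of_to_star f).elim
    · obtain rfl : f = 𝟙 _ := WithInitial.starInitial.hom_ext _ _
      ext x
      change a (F.map (𝟙 _) x) = G.map (𝟙 _) (a x)
      simp

lemma hom_ext {F G : (WithInitial C)ᵒᵖ ⥤ Type w} {η θ : F ⟶ G}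
    (h : ∀ x, η.app (op WithInitial.star) x = θ.app (op WithInitial.star) x)
    (h' : ∀ (c : C) x, η.app (op (WithInitial.incl.obj c)) x =
      θ.app (op (WithInitial.incl.obj c)) x) : η = θ := by
  ext ⟨c | _⟩ x
  exacts [h' c x, h x]

end WithInitialPresheaf

/-- The disjoint union of a family of presheaves. -/
def sigmaPresheaf {I : Type w} (P : I → Cᵒᵖ ⥤ Type w) : Cᵒᵖ ⥤ Type w where
  obj c := Σ i, (P i).obj c
  map f := ↾fun x => ⟨x.1, (P x.1).map f x.2⟩

/-- The presheaf on `WithInitial C` whose sections over the added object are the indices of a family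
of presheaves, and whose other sections are those of its disjoint union. -/
def gluedPresheaf {I : Type w} (P : I → Cᵒᵖ ⥤ Type w) : (WithInitial C)ᵒᵖ ⥤ Type w :=
  (WithInitial.lift (Z := op I) (sigmaPresheaf P).rightOp
    (fun _ => (↾fun x => x.1).op) (fun _ _ _ => rfl)).leftOp

variable (J : GrothendieckTopology C)

/-- A disjoint union of sheaves need not be a sheaf on C, since local sections may have different
indices. Here every cover contains the morphism from `star`, which forces a common index; gluing
then happens in one member. -/
lemma isSheaf_gluedPresheaf {I : Type w} (P : I → Cᵒᵖ ⥤ Type w)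
    (hP : ∀ i, Presieve.IsSheaf J (P i)) :
    Presieve.IsSheaf J.withInitial (gluedPresheaf P) := by
  rintro (c | _) S hS
  · have hS₂ : S.functorPullback WithInitial.incl ∈ J c :=
      (congrArg (fun R : Sieve (WithInitial.incl.obj c) => R.functorPullback WithInitial.incl ∈ J c)
        (Sieve.pullback_id (S := S))).mp (hS.2 c (𝟙 _))
    intro x hx
    -- The common index is the value of the matching family at `star`.
    let i : I := x _ hS.1
    have hx₁ (d : C) (f : d ⟶ c) (hf : S (WithInitial.incl.map f)) :
        ∃ y : (P i).obj (op d), x (WithInitial.incl.map f) hf = (⟨i, y⟩ : Σ i, (P i).obj (op d)) := by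
      have : (show Σ i, (P i).obj (op d) from x (WithInitial.incl.map f) hf).1 = i := by
        have := hx (𝟙 _) (WithInitial.homTo d) hS.1 hf (WithInitial.starInitial.hom_ext _ _)
        rw [op_id, Functor.map_id_apply] at this
        exact this.symm
      generalize x (WithInitial.incl.map f) hf = z at this
      obtain ⟨j, y⟩ := z
      obtain rfl : j = i := this
      exact ⟨y, rfl⟩
    choose y hy using hx₁
    have hyc : Presieve.FamilyOfElements.Compatible
        (R := (S.functorPullback WithInitial.incl : Presieve c)) (P := P i)
        (fun d f hf => y d f hf) := by
      intro d₁ d₂ d g₁ g₂ f₁ f₂ h₁ h₂ h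
      have := hx (WithInitial.incl.map g₁) (WithInitial.incl.map g₂) h₁ h₂
        (congrArg WithInitial.incl.map h)
      rw [hy d₁ f₁ h₁, hy d₂ f₂ h₂] at this
      exact eq_of_heq (Sigma.mk.inj this).2
    obtain ⟨t, ht, ht'⟩ := hP i _ hS₂ _ hyc
    refine ⟨(⟨i, t⟩ : Σ i, (P i).obj (op c)), ?_, ?_⟩
    · rintro (d | _) f hf
      · have : x f hf = _ := hy d (WithInitial.down f) hf
        exact (congrArg (Sigma.mk i) (ht (WithInitial.down f) hf)).trans this.symm
      · obtain rfl : f = WithInitial.starInitial.to _ := WithInitial.starInitial.hom_ext _ _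
        rfl
    · rintro ⟨j, t₁⟩ h
      obtain rfl : j = i := h _ hS.1
      have := ht' t₁ fun d f hf => by
        have := (h (WithInitial.incl.map f) hf).trans (hy d f hf)
        exact eq_of_heq (Sigma.mk.inj this).2
      rw [this]
  -- A cover of `star` contains the identity, so its sheaf condition is trivial.
  · obtain rfl : S = ⊤ := by
      have : WithInitial.starInitial.to WithInitial.star = 𝟙 (WithInitial.star : WithInitial C) :=
        WithInitial.starInitial.hom_ext _ _
      rw [← Sieve.id_mem_iff_eq_top, ← this]
      exact hS.1
    exact Presieve.isSheafFor_top _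

/-- The fibre of a presheaf on `WithInitial C` over a section on the added object. -/
def fiberPresheaf (F : (WithInitial C)ᵒᵖ ⥤ Type w) (i : F.obj (op WithInitial.star)) :
    Cᵒᵖ ⥤ Type w where
  obj c := { x : F.obj (op (WithInitial.incl.obj c.unop)) //
    F.map (WithInitial.homTo c.unop).op x = i}
  map {c d} f := ↾fun x => ⟨F.map (WithInitial.incl.map f.unop).op x.1, by
    rw [← Functor.map_comp_apply, ← op_comp]
    exact (congrArg (fun k => F.map k.op x.1) (WithInitial.starInitial.hom_ext _ _)).trans x.2⟩
  map_id c := by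
    ext x
    exact ConcreteCategory.congr_hom (F.map_id _) x.1
  map_comp f g := by
    ext x
    exact ConcreteCategory.congr_hom
      (F.map_comp (WithInitial.incl.map f.unop).op (WithInitial.incl.map g.unop).op) x.1

/-- The sieve of `WithInitial C` generated by a sieve of `C` and the added object. -/
def CategoryTheory.Sieve.withInitial {c : C} (S : Sieve c) : Sieve (WithInitial.incl.obj c) where
  -- For `Y = star` the condition is vacuous, so the morphism from `star` always belongs.
  arrows Y f := ∀ (d : C) (g : WithInitial.incl.obj d ⟶ Y), S (WithInitial.down (g ≫ f))
  downward_closed {_ _ f} hf g d k :=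
    (congrArg (fun m => S (WithInitial.down m)) (Category.assoc k g f)).mp (hf d (k ≫ g))

lemma CategoryTheory.Sieve.withInitial_map_iff {c d : C} (S : Sieve c) (f : d ⟶ c) :
    Sieve.withInitial S (WithInitial.incl.map f) ↔ S f := by
  constructor
  · intro h
    exact (congrArg (fun m => S (WithInitial.down m))
      (Category.id_comp (WithInitial.incl.map f))).mp (h d (𝟙 _))
  · intro h d' g
    exact S.downward_closed h (WithInitial.down g)

lemma CategoryTheory.Sieve.withInitial_mem {c : C} {S : Sieve c} (hS : S ∈ J c) :
    Sieve.withInitial S ∈ J.withInitial (WithInitial.incl.obj c) := by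
  refine ⟨fun d g => (WithInitial.false_of_to_star g).elim, fun d f => ?_⟩
  convert J.pullback_stable (WithInitial.down f) hS using 1
  ext d' g
  exact Sieve.withInitial_map_iff S (g ≫ WithInitial.down f)

lemma isSheaf_fiberPresheaf {F : (WithInitial C)ᵒᵖ ⥤ Type w}
    (hF : Presieve.IsSheaf J.withInitial F) (i : F.obj (op WithInitial.star)) :
    Presieve.IsSheaf J (fiberPresheaf F i) := by
  intro c S hS x hx
  rw [Presieve.compatible_iff_sieveCompatible] at hx
  -- The matching family in the fibre becomes one of `F` by taking the value `i` at `star`; its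
  -- gluing then lies over `i`.
  let y : Presieve.FamilyOfElements F (Sieve.withInitial S).arrows := fun Y f hf =>
    match Y, f, hf with
    | .of d, f, hf => (x (WithInitial.down f) ((Sieve.withInitial_map_iff S _).1 hf)).1
    | .star, _, _ => i
  have hy : y.Compatible := by
    rw [Presieve.compatible_iff_sieveCompatible]
    rintro (d | _) (d' | _) f g hf
    · exact congrArg Subtype.val
        (hx (WithInitial.down f) (WithInitial.down g) ((Sieve.withInitial_map_iff S _).1 hf))
    · obtain rfl : g = WithInitial.homTo d := WithInitial.starInitial.hom_ext _ _
      exact (x (WithInitial.down f) ((Sieve.withInitial_map_iff S _).1 hf)).2.symm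
    · exact (WithInitial.false_of_to_star g).elim
    · obtain rfl : g = 𝟙 _ := WithInitial.starInitial.hom_ext _ _
      exact (ConcreteCategory.congr_hom (F.map_id _) i).symm
  obtain ⟨t, ht, ht'⟩ := hF _ (Sieve.withInitial_mem J hS) y hy
  refine ⟨⟨t, ht _ (Sieve.withInitial_mem J hS).1⟩, fun d f hf => Subtype.ext
    (ht (WithInitial.incl.map f) ((Sieve.withInitial_map_iff S f).2 hf)), fun t₁ h => ?_⟩
  refine Subtype.ext (ht' t₁.1 ?_)
  rintro (d | _) f hf
  · exact congrArg Subtype.val (h (WithInitial.down f) ((Sieve.withInitial_map_iff S _).1 hf))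
  · obtain rfl : f = WithInitial.homTo c := WithInitial.starInitial.hom_ext _ _
    exact t₁.2

end Site

/-! ### The equivalence between families and sheaves on the enlarged site. -/

namespace Fam

variable {E : Type u} [Category.{w} E] {C : Type w} [SmallCategory C]
  {J : GrothendieckTopology C}

/-- The presheaf on `WithInitial C` given by a family of objects of `E`, for a functor from `E`
to sheaves on `C`. -/
def toPresheaf (e : E ⥤ Sheaf J (Type w)) : Fam E ⥤ (WithInitial C)ᵒᵖ ⥤ Type w where
  obj X := gluedPresheaf fun i => (e.obj (X.obj i)).obj
  map {X Y} m := WithInitialPresheaf.homMk m.f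
    (fun c (x : Σ i, (e.obj (X.obj i)).obj.obj (op c)) =>
      (⟨m.f x.1, (e.map (m.φ x.1)).hom.app (op c) x.2⟩ :
        Σ j, (e.obj (Y.obj j)).obj.obj (op c)))
    (by
      rintro c d f ⟨i, x⟩
      exact congrArg (Sigma.mk (m.f i))
        (ConcreteCategory.congr_hom ((e.map (m.φ i)).hom.naturality f.op) x))
    (fun _ _ => rfl)
  map_id X := WithInitialPresheaf.hom_ext (fun _ => rfl) (by
    rintro c ⟨i, x⟩
    exact congrArg (Sigma.mk i)
      (congrArg (fun h : e.obj (X.obj i) ⟶ _ => h.hom.app (op c) x) (e.map_id (X.obj i))))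
  map_comp {X Y Z} f g := WithInitialPresheaf.hom_ext (fun _ => rfl) (by
    rintro c ⟨i, x⟩
    exact congrArg (Sigma.mk (g.f (f.f i)))
      (congrArg (fun h : e.obj (X.obj i) ⟶ _ => h.hom.app (op c) x)
        (e.map_comp (f.φ i) (g.φ (f.f i)))))

/-- The functor from families of objects of `E` to sheaves on `WithInitial C`. -/
def toSheaf (e : E ⥤ Sheaf J (Type w)) : Fam E ⥤ Sheaf J.withInitial (Type w) :=
  ObjectProperty.lift _ (toPresheaf e) fun X =>
    (isSheaf_iff_isSheaf_of_type _ _).2 (isSheaf_gluedPresheaf J _ fun i =>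
      (isSheaf_iff_isSheaf_of_type _ _).1 (e.obj (X.obj i)).property)

variable (e : E ⥤ Sheaf J (Type w))

instance [e.Faithful] : (toPresheaf e).Faithful where
  map_injective {X Y} m n h := by
    obtain ⟨f, φ⟩ := m
    obtain ⟨g, ψ⟩ := n
    obtain rfl : f = g := funext fun i =>
      congrArg (fun η : (toPresheaf e).obj X ⟶ (toPresheaf e).obj Y =>
        η.app (op WithInitial.star) i) h
    congr
    funext i
    apply e.map_injective
    ext c x
    have : (⟨f i, (e.map (φ i)).hom.app c x⟩ : Σ j, (e.obj (Y.obj j)).obj.obj c) =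
        ⟨f i, (e.map (ψ i)).hom.app c x⟩ :=
      congrArg (fun η : (toPresheaf e).obj X ⟶ (toPresheaf e).obj Y =>
        η.app (op (WithInitial.incl.obj c.unop)) (⟨i, x⟩ : Σ i, (e.obj (X.obj i)).obj.obj c)) h
    exact eq_of_heq (Sigma.mk.inj this).2

instance [e.Full] : (toPresheaf e).Full where
  map_surjective {X Y} η := by
    let f : X.I → Y.I := η.app (op WithInitial.star)
    let a (c : C) : (Σ i, (e.obj (X.obj i)).obj.obj (op c)) →
        Σ j, (e.obj (Y.obj j)).obj.obj (op c) := η.app (op (WithInitial.incl.obj c))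
    -- Naturality along `star ⟶ c` makes `η` act on indices by `f`, so it splits into morphisms
    -- between members.
    have ha (c : C) (i : X.I) (x : (e.obj (X.obj i)).obj.obj (op c)) :
        ∃ y, a c ⟨i, x⟩ = ⟨f i, y⟩ := by
      have h := ConcreteCategory.congr_hom (η.naturality (WithInitial.homTo c).op)
        (⟨i, x⟩ : Σ i, (e.obj (X.obj i)).obj.obj (op c))
      have : (a c ⟨i, x⟩).1 = f i := h.symm
      generalize a c ⟨i, x⟩ = z at this
      obtain ⟨j, y⟩ := z
      obtain rfl : j = f i := this
      exact ⟨y, rfl⟩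
    choose y hy using ha
    let φ (i : X.I) : e.obj (X.obj i) ⟶ e.obj (Y.obj (f i)) :=
      ⟨{ app := fun c => ↾fun x => y c.unop i x
         naturality := fun c d g => by
          ext x
          have := ConcreteCategory.congr_hom (η.naturality (WithInitial.incl.map g.unop).op)
            (⟨i, x⟩ : Σ i, (e.obj (X.obj i)).obj.obj c)
          have h₁ := (hy d.unop i ((e.obj (X.obj i)).obj.map g x)).symm.trans (this.trans
            (congrArg (((toPresheaf e).obj Y).map (WithInitial.incl.map g.unop).op)
              (hy c.unop i x)))
          exact eq_of_heq (Sigma.mk.inj h₁).2 }⟩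
    refine ⟨⟨f, fun i => e.preimage (φ i)⟩, WithInitialPresheaf.hom_ext (fun _ => rfl) ?_⟩
    rintro c ⟨i, x⟩
    refine Eq.trans ?_ (hy c i x).symm
    exact congrArg (Sigma.mk (f i))
      (congrArg (fun h : e.obj (X.obj i) ⟶ e.obj (Y.obj (f i)) => h.hom.app (op c) x)
        (e.map_preimage (φ i)))

instance [e.Faithful] : (toSheaf e).Faithful :=
  inferInstanceAs (ObjectProperty.lift _ (toPresheaf e) _).Faithful

instance [e.Full] : (toSheaf e).Full :=
  inferInstanceAs (ObjectProperty.lift _ (toPresheaf e) _).Full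

/-- The family is that of the fibres of `F`; for each c, the set F(c) is the disjoint union of its
fibres over F(star), so `η` is bijective. -/
instance [e.EssSurj] : (toSheaf e).EssSurj where
  mem_essImage F := by
    let P (i : F.obj.obj (op WithInitial.star)) : Sheaf J (Type w) :=
      ⟨fiberPresheaf F.obj i, (isSheaf_iff_isSheaf_of_type _ _).2
        (isSheaf_fiberPresheaf J ((isSheaf_iff_isSheaf_of_type _ _).1 F.property) i)⟩
    let X : Fam E := ⟨F.obj.obj (op WithInitial.star), fun i => e.objPreimage (P i)⟩
    let k (i : X.I) : e.obj (X.obj i) ≅ P i := e.objObjPreimageIso (P i)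
    let η : (toPresheaf e).obj X ⟶ F.obj := WithInitialPresheaf.homMk
      (fun i => i)
      (fun c (x : Σ i, (e.obj (X.obj i)).obj.obj (op c)) => ((k x.1).hom.hom.app (op c) x.2).1)
      (by
        rintro c d f ⟨i, x⟩
        exact congrArg Subtype.val
          (ConcreteCategory.congr_hom ((k i).hom.hom.naturality f.op) x))
      (by
        rintro c ⟨i, x⟩
        exact ((k i).hom.hom.app (op c) x).2.symm)
    have hk (c : C) (i : X.I) : Function.Bijective ((k i).hom.hom.app (op c)) :=
      (isIso_iff_bijective _).1
        (inferInstanceAs (IsIso (((sheafToPresheaf J _).map (k i).hom).app (op c))))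
    have (c : (WithInitial C)ᵒᵖ) : IsIso (η.app c) := by
      rw [isIso_iff_bijective]
      obtain ⟨c | _⟩ := c
      · constructor
        · rintro ⟨i, x⟩ ⟨j, y⟩ h
          replace h : ((k i).hom.hom.app (op c) x).1 = ((k j).hom.hom.app (op c) y).1 := h
          obtain rfl : i = j := by
            rw [← ((k i).hom.hom.app (op c) x).2, ← ((k j).hom.hom.app (op c) y).2, h]
          exact congrArg (Sigma.mk i) ((hk c i).1 (Subtype.ext h))
        · intro y
          obtain ⟨x, hx⟩ := (hk c (F.obj.map (WithInitial.homTo c).op y)).2 ⟨y, rfl⟩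
          exact ⟨(⟨_, x⟩ : Σ i, (e.obj (X.obj i)).obj.obj (op c)), congrArg Subtype.val hx⟩
      · exact Function.bijective_id
    have : IsIso η := NatIso.isIso_of_isIso_app η
    let α : (toPresheaf e).obj X ≅ F.obj := asIso η
    exact ⟨X, ⟨(fullyFaithfulSheafToPresheaf J.withInitial _).preimageIso α⟩⟩

instance [e.IsEquivalence] : (toSheaf e).IsEquivalence where

lemma isGrothendieckTopos [IsGrothendieckTopos E] : IsGrothendieckTopos (Fam E) := by
  obtain ⟨C, _, J, ⟨e⟩⟩ := IsGrothendieckTopos.exists_site (E := E)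
  exact ⟨WithInitial C, inferInstance, J.withInitial, ⟨(toSheaf e.functor).asEquivalence⟩⟩

/-! ### The inverse image functor. -/

/-- The presheaf on `C` given by the disjoint union of a family of objects of `E`. -/
def sigma : Fam E ⥤ Cᵒᵖ ⥤ Type w :=
  toSheaf e ⋙ sheafToPresheaf _ _ ⋙ (Functor.whiskeringLeft _ _ _).obj WithInitial.incl.op

/-- `sigma e` is an equivalence followed by the inclusion of sheaves and a restriction, all of which
preserve limits. -/
instance [e.IsEquivalence] : PreservesFiniteLimits (sigma e) := by
  unfold sigma
  infer_instance

/-- Morphisms from the disjoint union of a family to a sheaf are families of morphisms. -/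
def sigmaHomEquiv (he : e.FullyFaithful) (X : Fam E) (Y : E) :
    ((sigma e).obj X ⟶ (e.obj Y).obj) ≃ (X ⟶ (Fam.singleton E).obj Y) where
  toFun η := ⟨fun _ => PUnit.unit, fun i => he.preimage ⟨
    { app := fun c => ↾fun x => η.app c (⟨i, x⟩ : Σ i, (e.obj (X.obj i)).obj.obj c)
      naturality := fun c d f => by
        ext x
        exact ConcreteCategory.congr_hom (η.naturality f)
          (⟨i, x⟩ : Σ i, (e.obj (X.obj i)).obj.obj c) }⟩⟩
  invFun m :=
    { app := fun c => ↾fun (x : Σ i, (e.obj (X.obj i)).obj.obj c) =>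
        (e.map (m.φ x.1)).hom.app c x.2
      naturality := fun c d f => by
        ext ⟨i, x⟩
        exact ConcreteCategory.congr_hom ((e.map (m.φ i)).hom.naturality f) x }
  left_inv η := by
    ext c ⟨i, x⟩
    exact congrArg (fun h : e.obj (X.obj i) ⟶ e.obj Y => h.hom.app c x) (he.map_preimage _)
  right_inv m := FormalCoproduct.hom_ext rfl fun i => by
    refine (Category.comp_id _).trans ?_
    refine Eq.trans ?_ (he.preimage_map (m.φ i))
    refine congrArg he.preimage ?_
    rfl

lemma exists_geometricMorphism [IsGrothendieckTopos E] :
    ∃ i : GeometricMorphism E (Fam E), i.directImage = Fam.singleton E := by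
  obtain ⟨C, _, J, ⟨e⟩⟩ := IsGrothendieckTopos.exists_site (E := E)
  let adj : presheafToSheaf J (Type w) ⋙ e.inverse ⊣ e.functor ⋙ sheafToPresheaf J (Type w) :=
    (sheafificationAdjunction J (Type w)).comp e.symm.toAdjunction
  have : PreservesFiniteLimits e.inverse := inferInstance
  refine ⟨⟨Fam.singleton E, sigma e.functor ⋙ presheafToSheaf J (Type w) ⋙ e.inverse,
    Adjunction.mkOfHomEquiv
      { homEquiv := fun X Y => (adj.homEquiv _ Y).trans
          (sigmaHomEquiv e.functor e.fullyFaithfulFunctor X Y)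
        homEquiv_naturality_left_symm := ?_
        homEquiv_naturality_right := ?_ }, inferInstance⟩, rfl⟩
  · intro X X' Y f g
    refine (congrArg (adj.homEquiv _ Y).symm ?_).trans
      (adj.homEquiv_naturality_left_symm ((sigma e.functor).map f) _)
    ext c ⟨i, x⟩
    exact congrArg (fun h : e.functor.obj (X.obj i) ⟶ e.functor.obj Y => h.hom.app c x)
      (e.functor.map_comp (f.φ i) (g.φ (f.f i)))
  · intro X Y Y' f g
    refine (congrArg (sigmaHomEquiv e.functor e.fullyFaithfulFunctor X Y')
      (adj.homEquiv_naturality_right f g)).trans ?_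
    -- On the presheaf side both morphisms are given by explicit components, and the claim becomes
    -- functoriality of `e.functor`.
    refine (sigmaHomEquiv e.functor e.fullyFaithfulFunctor X Y').symm.injective ?_
    rw [Equiv.symm_apply_apply]
    obtain ⟨m, hm⟩ := (sigmaHomEquiv e.functor e.fullyFaithfulFunctor X Y).symm.surjective
      (adj.homEquiv _ Y f)
    rw [Equiv.trans_apply, ← hm, Equiv.apply_symm_apply]
    ext c ⟨i, x⟩
    exact (congrArg (fun h : e.functor.obj (X.obj i) ⟶ e.functor.obj Y' => h.hom.app c x)
      (e.functor.map_comp (m.φ i) g)).symm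

end Fam

theorem mainTheorem3 {E : Type u} [Category.{w} E] [IsGrothendieckTopos E] :
    (∃ (F : Type (max u (w + 1))) (_ : Category.{w} F),
      IsCompletelyConnected F ∧ IsClosedSubtopos E F) ∧
    IsCompletelyConnected (Fam E) ∧
    IsContainerObject (Fam.box E) ∧
    ∃ i : GeometricMorphism E (Fam E),
      Nonempty (i.directImage ≅ Fam.singleton E) ∧ IsClosedComplement i (Fam.box E) := by
  have h := Fam.isCompletelyConnected E Fam.isGrothendieckTopos
  obtain ⟨i, hi⟩ := Fam.exists_geometricMorphism (E := E)
  have hc := Fam.isClosedComplement_box i hi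
  exact ⟨⟨Fam E, inferInstance, h, i, Fam.box E, hc⟩, h, isContainerObject_box E,
    i, ⟨eqToIso hi⟩, hc⟩
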